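/- Let $L\ge 1$ be an integer and let $\alpha>0$. For $\ell=1,\dots,L$ let $T_\ell>0$, $\hat r_\ell>0$ and let $(\varphi_{i,\ell})_{i\ge 0}$ be a real sequence with $\varphi_{0,\ell}\neq 0$. Let $R_1,\dots,R_L$ be independent (not necessarily identically distributed) random variables with support in $[0,\infty)$ such that each $R_\ell$ is an $\alpha$-$\mu$ mixture, that is, it has the probability density $$f_{R_\ell}(r)=\alpha\exp\!\left(-\frac{r^\alpha}{\hat r_\ell^{\alpha}}\right)\sum_{i=0}^{\infty}\frac{\varphi_{i,\ell}\,r^{\alpha(i+T_\ell)-1}}{\hat r_\ell^{\alpha(i+T_\ell)}\,\Gamma(i+T_\ell)}\ \ (r>0),$$ where the series converges absolutely for every $r>0$ and $f_{R_\ell}\ge 0$ there. Let $R=\sum_{\ell=1}^{L}R_\ell$. Define, for $i\ge 0$, $$\lambda_{i,\ell}=\frac{\Gamma(\alpha(i+T_\ell))}{\hat r_\ell^{\alpha i}}\sum_{j=0}^{i}\frac{(-1)^{i-j}\varphi_{j,\ell}}{(i-j)!\,\Gamma(j+T_\ell)},$$ $$\phi_{0,\ell}=\frac{\lambda_{1,\ell}}{\lambda_{0,\ell}},\qquad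 \phi_{h,\ell}=\frac{1}{\lambda_{0,\ell}}\left[(h+1)\lambda_{h+1,\ell}-\sum_{t=1}^{h}\lambda_{t,\ell}\,\phi_{h-t,\ell}\right]\ (h\ge 1),$$ $$\delta_0=\prod_{\ell=1}^{L}\lambda_{0,\ell},\qquad \delta_i=\frac1i\sum_{h=1}^{i}\delta_{i-h}\sum_{\ell=1}^{L}\phi_{h-1,\ell}\ (i\ge 1).$$ Then $R$ has a probability density $f_R$, supported on $[0,\infty)$, and a cumulative distribution function $F_R$, given by $$f_R(r)=\alpha^L\left(\prod_{\ell=1}^{L}\frac{1}{\hat r_\ell^{\alpha T_\ell}}\right)\sum_{i=0}^{\infty}\frac{\delta_i\,r^{-1+\alpha i+\alpha\sum_{\ell=1}^{L} T_\ell}}{\Gamma\!\left(i\alpha+\alpha\sum_{\ell=1}^{L} T_\ell\right)}\ \ (r>0),$$ $$F_R(r)=\alpha^L\left(\prod_{\ell=1}^{L}\frac{1}{\hat r_\ell^{\alpha T_\ell}}\right)\sum_{i=0}^{\infty}\frac{\delta_i\,r^{\alpha i+\alpha\sum_{\ell=1}^{L} T_\ell}}{\Gamma\!\left(1+i\alpha+\alpha\sum_{\ell=1}^{L}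 T_\ell\right)}\ \ (r\ge 0),$$ where both series converge absolutely for all such $r$. -/

import Mathlib

open MeasureTheory ProbabilityTheory

noncomputable section

namespace AlphaMu

/-- The random variable `X` is supported on `[0, ∞)` and has the (nonnegative) probability density
`f` there: `X` has a density with respect to Lebesgue measure, equal to `f r` for almost every
`r > 0` and to `0` for almost every `r ≤ 0`. -/
structure HasPosDensity {Ω : Type*} [MeasurableSpace Ω] (P : Measure Ω) (X : Ω → ℝ)
    (f : ℝ → ℝ) : Prop where
  hasPDF : HasPDF X P volume
  nonneg : ∀ r : ℝ, 0 < r → 0 ≤ f r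
  pdf_ae : pdf X P volume =ᵐ[volume] fun r => ENNReal.ofReal (if 0 < r then f r else 0)

/-- The `i`-th term of the series in the density of an α-μ mixture. -/
def mixtureTerm (α T rhat : ℝ) (φ : ℕ → ℝ) (r : ℝ) (i : ℕ) : ℝ :=
  φ i * r ^ (α * (i + T) - 1) / (rhat ^ (α * (i + T)) * Real.Gamma (i + T))

/-- The density of an α-μ mixture. -/
def mixtureDensity (α T rhat : ℝ) (φ : ℕ → ℝ) (r : ℝ) : ℝ :=
  α * Real.exp (-(r ^ α / rhat ^ α)) * ∑' i : ℕ, mixtureTerm α T rhat φ r i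

/-- `X` is an α-μ mixture with the given parameters: the series defining the density converges
at every `r > 0`, and its value is the probability density of `X`. -/
structure IsMixture {Ω : Type*} [MeasurableSpace Ω] (P : Measure Ω) (X : Ω → ℝ)
    (α T rhat : ℝ) (φ : ℕ → ℝ) : Prop where
  summable : ∀ r : ℝ, 0 < r → Summable (mixtureTerm α T rhat φ r)
  density : HasPosDensity P X (mixtureDensity α T rhat φ)

/-- The coefficients `λ_i`. -/
def lam (α T rhat : ℝ) (φ : ℕ → ℝ) (i : ℕ) : ℝ :=
  Real.Gamma (α * (i + T)) / rhat ^ (α * i) *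
    ∑ j ∈ Finset.range (i + 1),
      (-1) ^ (i - j) * φ j / (((i - j).factorial : ℝ) * Real.Gamma (j + T))

/-- The auxiliary coefficients `ϕ_h` attached to a sequence `η`; the sum is over `1 ≤ t ≤ h`,
shifted by one. -/
def phiCoeff (η : ℕ → ℝ) (h : ℕ) : ℝ :=
  1 / η 0 * (((h : ℝ) + 1) * η (h + 1) - ∑ t : Fin h, η (t + 1) * phiCoeff η (h - (t + 1)))
termination_by h
decreasing_by omega

/-- The coefficients `δ_i` attached to finitely many sequences `η ℓ`; in the recursion the sum is
over `1 ≤ h ≤ i`, shifted by one. -/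
def deltaCoeff {L : ℕ} (η : Fin L → ℕ → ℝ) : ℕ → ℝ
  | 0 => ∏ ℓ, η ℓ 0
  | i + 1 => 1 / ((i : ℝ) + 1) *
      ∑ h : Fin (i + 1), deltaCoeff η (i - h) * ∑ ℓ, phiCoeff (η ℓ) h
termination_by i => i
decreasing_by omega

theorem phiCoeff_zero (η : ℕ → ℝ) : phiCoeff η 0 = η 1 / η 0 := by
  rw [phiCoeff]
  simp [div_eq_inv_mul]

theorem phiCoeff_eq (η : ℕ → ℝ) (h : ℕ) :
    phiCoeff η h = 1 / η 0 *
      (((h : ℝ) + 1) * η (h + 1) - ∑ t ∈ Finset.Icc 1 h, η t * phiCoeff η (h - t)) := by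
  rw [phiCoeff, Fin.sum_univ_eq_sum_range (fun t => η (t + 1) * phiCoeff η (h - (t + 1))),
    Finset.range_eq_Ico, Finset.sum_Ico_add' (fun t => η t * phiCoeff η (h - t)) 0 h 1]
  rfl

theorem deltaCoeff_zero {L : ℕ} (η : Fin L → ℕ → ℝ) : deltaCoeff η 0 = ∏ ℓ, η ℓ 0 := by
  rw [deltaCoeff]

theorem deltaCoeff_eq {L : ℕ} (η : Fin L → ℕ → ℝ) (i : ℕ) (hi : 1 ≤ i) :
    deltaCoeff η i = 1 / (i : ℝ) *
      ∑ h ∈ Finset.Icc 1 i, deltaCoeff η (i - h) * ∑ ℓ, phiCoeff (η ℓ) (h - 1) := by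
  obtain ⟨i, rfl⟩ := Nat.exists_eq_add_of_le' hi
  have e : ∑ h ∈ Finset.range (i + 1), deltaCoeff η (i - h) * ∑ ℓ, phiCoeff (η ℓ) h =
      ∑ h ∈ Finset.Icc 1 (i + 1),
        deltaCoeff η (i + 1 - h) * ∑ ℓ, phiCoeff (η ℓ) (h - 1) := by
    have := Finset.sum_Ico_add'
      (fun h => deltaCoeff η (i + 1 - h) * ∑ ℓ, phiCoeff (η ℓ) (h - 1)) 0 (i + 1) 1
    rw [Finset.range_eq_Ico]
    simp only [Nat.add_sub_add_right, Nat.add_sub_cancel] at this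
    exact this
  rw [← e, deltaCoeff,
    ← Fin.sum_univ_eq_sum_range (fun h => deltaCoeff η (i - h) * ∑ ℓ, phiCoeff (η ℓ) h)]
  push_cast
  rfl

end AlphaMu

end

/-!
The kernels `k_a(r) = r ^ (a - 1) / Γ(a)` satisfy `k_a * k_b = k_(a + b)` under convolution on the
half-line. Convolving two series `∑ cᵢ k_(α i + A)` and `∑ dⱼ k_(α j + B)` therefore multiplies the
coefficient power series `∑ cᵢ Xⁱ` and `∑ dⱼ Xʲ`. Term-by-term integration is justified because
`k_(a + b)(z) = z B(a, b) k_a(z) k_b(z)` and the beta function `B` is decreasing in both arguments,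
so the integrated double series is dominated by a product of two absolutely convergent series.

Expanding the exponential shows that the density of an α-μ mixture is such a series with
coefficients proportional to `λ`, so by independence the density of the sum has coefficients
proportional to those of the product of the generating functions of the `λ_ℓ`. The recursions for
`ϕ` and `δ` say that `∑ ϕ_(h,ℓ) Xʰ` is the logarithmic derivative of the generating function of
`λ_ℓ`, and that the generating function of `δ` has the sum of these as logarithmic derivative; it is
therefore that product. Convolving with `k_1 = 1` turns the density into the distribution function.
-/

noncomputable section

namespace AlphaMu

open PowerSeries Set Finset.HasAntidiagonal

section BetaFunction

variable {a b A B z : ℝ}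

theorem intervalIntegral_rpow_mul_sub_rpow (ha : 0 < a) (hb : 0 < b) (hz : 0 < z) :
    ∫ y in (0 : ℝ)..z, y ^ (a - 1) * (z - y) ^ (b - 1) = z ^ (a + b - 1) * beta a b := by
  have hcomplex := Complex.betaIntegral_scaled a b hz
  have hcast : ∫ y in (0 : ℝ)..z, (y : ℂ) ^ ((a : ℂ) - 1) * ((z : ℂ) - y) ^ ((b : ℂ) - 1) =
      ((∫ y in (0 : ℝ)..z, y ^ (a - 1) * (z - y) ^ (b - 1) : ℝ) : ℂ) := by
    rw [← intervalIntegral.integral_ofReal]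
    refine intervalIntegral.integral_congr fun y hy => ?_
    rw [uIcc_of_le hz.le] at hy
    push_cast [Complex.ofReal_cpow hy.1, Complex.ofReal_cpow (sub_nonneg.2 hy.2)]
    rfl
  have hscale : (z : ℂ) ^ ((a : ℂ) + b - 1) = ((z ^ (a + b - 1) : ℝ) : ℂ) := by
    push_cast [Complex.ofReal_cpow hz.le]
    rfl
  rw [hcast, hscale] at hcomplex
  rw [beta_eq_betaIntegralReal a b ha hb, ← Complex.re_ofReal_mul, ← hcomplex,
    Complex.ofReal_re]

theorem beta_le_beta (hA : 0 < A) (hB : 0 < B) (ha : A ≤ a) (hb : B ≤ b) :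
    beta a b ≤ beta A B := by
  have integral_eq {x y : ℝ} (hx : 0 < x) (hy : 0 < y) :
      ∫ t in (0 : ℝ)..1, t ^ (x - 1) * (1 - t) ^ (y - 1) = beta x y := by
    rw [intervalIntegral_rpow_mul_sub_rpow hx hy one_pos, Real.one_rpow, one_mul]
  have integrable {x y : ℝ} (hx : 0 < x) (hy : 0 < y) :
      IntervalIntegrable (fun t : ℝ => t ^ (x - 1) * (1 - t) ^ (y - 1)) volume 0 1 :=
    intervalIntegral.intervalIntegrable_of_integral_ne_zero
      ((integral_eq hx hy).trans_ne (beta_pos hx hy).ne')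
  have ha₀ := hA.trans_le ha
  have hb₀ := hB.trans_le hb
  rw [← integral_eq ha₀ hb₀, ← integral_eq hA hB]
  refine intervalIntegral.integral_mono_on_of_le_Ioo zero_le_one (integrable ha₀ hb₀)
    (integrable hA hB) fun t ht => ?_
  have ht' : 0 < 1 - t := sub_pos.2 ht.2
  exact mul_le_mul (Real.rpow_le_rpow_of_exponent_ge ht.1 ht.2.le (by linarith))
    (Real.rpow_le_rpow_of_exponent_ge ht' (by linarith [ht.1]) (by linarith))
    (Real.rpow_nonneg ht'.le _) (Real.rpow_nonneg ht.1.le _)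

end BetaFunction

/-- The Riemann–Liouville kernel `r ^ (a - 1) / Γ(a)` on the positive half-line: convolution with it
is fractional integration of order `a`. -/
def fracKernel (a r : ℝ) : ℝ := r ^ (a - 1) / Real.Gamma a

section FracKernel

variable {a b A B r z : ℝ}

theorem fracKernel_one (r : ℝ) : fracKernel 1 r = 1 := by
  simp [fracKernel]

theorem fracKernel_zero_right (ha : a ≠ 1) : fracKernel a 0 = 0 := by
  rw [fracKernel, Real.zero_rpow (sub_ne_zero.2 ha), zero_div]

theorem fracKernel_pos (ha : 0 < a) (hr : 0 < r) : 0 < fracKernel a r :=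
  div_pos (Real.rpow_pos_of_pos hr _) (Real.Gamma_pos_of_pos ha)

theorem setIntegral_fracKernel_mul (ha : 0 < a) (hb : 0 < b) (hz : 0 < z) :
    ∫ y in Ioo 0 z, fracKernel a y * fracKernel b (z - y) = fracKernel (a + b) z := by
  have := Real.Gamma_pos_of_pos ha
  have := Real.Gamma_pos_of_pos hb
  have hfactor (y : ℝ) : fracKernel a y * fracKernel b (z - y) =
      (Real.Gamma a * Real.Gamma b)⁻¹ * (y ^ (a - 1) * (z - y) ^ (b - 1)) := by
    unfold fracKernel
    field_simp
  simp_rw [hfactor]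
  rw [integral_const_mul, ← integral_Ioc_eq_integral_Ioo,
    ← intervalIntegral.integral_of_le hz.le, intervalIntegral_rpow_mul_sub_rpow ha hb hz,
    fracKernel, beta]
  field_simp

theorem integrableOn_fracKernel_mul (ha : 0 < a) (hb : 0 < b) (hz : 0 < z) :
    IntegrableOn (fun y => fracKernel a y * fracKernel b (z - y)) (Ioo 0 z) :=
  Integrable.of_integral_ne_zero <|
    (setIntegral_fracKernel_mul ha hb hz).trans_ne (fracKernel_pos (add_pos ha hb) hz).ne'

theorem fracKernel_add (ha : 0 < a) (hb : 0 < b) (hz : 0 < z) :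
    fracKernel (a + b) z = z * beta a b * (fracKernel a z * fracKernel b z) := by
  have := Real.Gamma_pos_of_pos ha
  have := Real.Gamma_pos_of_pos hb
  have hpow : z ^ (a + b - 1) = z * (z ^ (a - 1) * z ^ (b - 1)) := by
    rw [show a + b - 1 = 1 + (a - 1) + (b - 1) by ring, Real.rpow_add hz, Real.rpow_add hz,
      Real.rpow_one, mul_assoc]
  unfold fracKernel beta
  rw [hpow]
  field_simp

theorem fracKernel_add_le (hA : 0 < A) (hB : 0 < B) (ha : A ≤ a) (hb : B ≤ b) (hz : 0 < z) :
    fracKernel (a + b) z ≤ z * beta A B * (fracKernel a z * fracKernel b z) := by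
  have hka := fracKernel_pos (hA.trans_le ha) hz
  have hkb := fracKernel_pos (hB.trans_le hb) hz
  rw [fracKernel_add (hA.trans_le ha) (hB.trans_le hb) hz]
  gcongr
  exact beta_le_beta hA hB ha hb

end FracKernel

/-- The `i`-th term of the fractional power series `fracSeries α A c r`. -/
def fracTerm (α A : ℝ) (c : ℝ⟦X⟧) (r : ℝ) (i : ℕ) : ℝ := coeff i c * fracKernel (α * i + A) r

/-- The fractional power series `∑ cᵢ r ^ (α i + A - 1) / Γ(α i + A)`. Its coefficients are bundled
as a formal power series because convolution multiplies the coefficient series. -/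
def fracSeries (α A : ℝ) (c : ℝ⟦X⟧) (r : ℝ) : ℝ := ∑' i, fracTerm α A c r i

section FracSeries

variable {α A B : ℝ} {c d : ℝ⟦X⟧}

theorem fracTerm_C_mul (α A K : ℝ) (c : ℝ⟦X⟧) (r : ℝ) :
    fracTerm α A (C K * c) r = fun i => K * fracTerm α A c r i := by
  funext i
  rw [fracTerm, coeff_C_mul, mul_assoc, fracTerm]

theorem summable_fracTerm_C_mul_iff {K r : ℝ} (hK : K ≠ 0) :
    Summable (fracTerm α A (C K * c) r) ↔ Summable (fracTerm α A c r) := by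
  rw [fracTerm_C_mul, summable_mul_left_iff hK]

theorem fracSeries_C_mul (α A K : ℝ) (c : ℝ⟦X⟧) (r : ℝ) :
    fracSeries α A (C K * c) r = K * fracSeries α A c r := by
  rw [fracSeries, fracTerm_C_mul, tsum_mul_left, fracSeries]

theorem hasSum_fracTerm_one (α A r : ℝ) : HasSum (fracTerm α A 1 r) (fracKernel A r) := by
  have h := hasSum_single (f := fracTerm α A 1 r) 0 fun i hi => by
    rw [fracTerm, coeff_one, if_neg hi, zero_mul]
  simpa [fracTerm] using h

theorem fracTerm_zero_right (hα : 0 ≤ α) (hA : 1 < A) : fracTerm α A c 0 = 0 := by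
  funext i
  have hexp : α * i + A ≠ 1 := by
    have : 0 ≤ α * i := by positivity
    linarith
  rw [fracTerm, fracKernel_zero_right hexp, mul_zero, Pi.zero_apply]

/-- The terms of the double series obtained by convolving `fracSeries α A c` with
`fracSeries α B d` term by term. -/
def fracMulTerm (α A B : ℝ) (c d : ℝ⟦X⟧) (z : ℝ) (p : ℕ × ℕ) : ℝ :=
  coeff p.1 c * coeff p.2 d * fracKernel (α * p.1 + A + (α * p.2 + B)) z

theorem le_mul_natCast_add (hα : 0 ≤ α) (i : ℕ) : A ≤ α * i + A :=
  le_add_of_nonneg_left (by positivity)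

theorem mul_natCast_add_pos (hα : 0 ≤ α) (hA : 0 < A) (i : ℕ) : 0 < α * i + A :=
  hA.trans_le (le_mul_natCast_add hα i)

theorem norm_fracMulTerm_le (hα : 0 ≤ α) (hA : 0 < A) (hB : 0 < B) {z : ℝ} (hz : 0 < z)
    (p : ℕ × ℕ) : ‖fracMulTerm α A B c d z p‖ ≤
      z * beta A B * ‖fracTerm α A c z p.1 * fracTerm α B d z p.2‖ := by
  have ha := le_mul_natCast_add (A := A) hα p.1
  have hb := le_mul_natCast_add (A := B) hα p.2
  have hka := fracKernel_pos (hA.trans_le ha) hz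
  have hkb := fracKernel_pos (hB.trans_le hb) hz
  have hkab := fracKernel_pos (add_pos (hA.trans_le ha) (hB.trans_le hb)) hz
  calc ‖fracMulTerm α A B c d z p‖
      = ‖coeff p.1 c‖ * ‖coeff p.2 d‖ * fracKernel (α * p.1 + A + (α * p.2 + B)) z := by
        rw [fracMulTerm, norm_mul, norm_mul, Real.norm_of_nonneg hkab.le]
    _ ≤ ‖coeff p.1 c‖ * ‖coeff p.2 d‖ * (z * beta A B *
          (fracKernel (α * p.1 + A) z * fracKernel (α * p.2 + B) z)) := by
        gcongr
        exact fracKernel_add_le hA hB ha hb hz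
    _ = z * beta A B * ‖fracTerm α A c z p.1 * fracTerm α B d z p.2‖ := by
        simp only [fracTerm, norm_mul, Real.norm_of_nonneg hka.le, Real.norm_of_nonneg hkb.le]
        ring

theorem summable_norm_fracMulTerm (hα : 0 ≤ α) (hA : 0 < A) (hB : 0 < B) {z : ℝ} (hz : 0 < z)
    (hc : Summable (fracTerm α A c z)) (hd : Summable (fracTerm α B d z)) :
    Summable fun p => ‖fracMulTerm α A B c d z p‖ :=
  ((summable_mul_of_summable_norm hc.norm hd.norm).norm.mul_left _).of_nonneg_of_le
    (fun _ => norm_nonneg _) (norm_fracMulTerm_le hα hA hB hz)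

theorem fracTerm_mul (α A B : ℝ) (c d : ℝ⟦X⟧) (z : ℝ) (n : ℕ) :
    fracTerm α (A + B) (c * d) z n = ∑ p ∈ antidiagonal n, fracMulTerm α A B c d z p := by
  rw [fracTerm, coeff_mul, Finset.sum_mul]
  refine Finset.sum_congr rfl fun p hp => ?_
  rw [fracMulTerm, ← mem_antidiagonal.1 hp]
  congr 2
  push_cast
  ring

theorem hasSum_fracTerm_mul (hα : 0 ≤ α) (hA : 0 < A) (hB : 0 < B) {z : ℝ} (hz : 0 < z)
    (hc : Summable (fracTerm α A c z)) (hd : Summable (fracTerm α B d z)) :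
    HasSum (fracTerm α (A + B) (c * d) z) (∑' p, fracMulTerm α A B c d z p) := by
  have hdouble := (summable_norm_fracMulTerm hα hA hB hz hc hd).of_norm.hasSum
  rw [← Finset.HasAntidiagonal.sigmaAntidiagonalEquivProd.hasSum_iff] at hdouble
  refine hdouble.sigma fun n => ?_
  rw [fracTerm_mul, ← Finset.sum_coe_sort]
  exact hasSum_fintype _

theorem fracTerm_mul_fracTerm (α A B : ℝ) (c d : ℝ⟦X⟧) (y w : ℝ) (i j : ℕ) :
    fracTerm α A c y i * fracTerm α B d w j =
      coeff i c * coeff j d * (fracKernel (α * i + A) y * fracKernel (α * j + B) w) :=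
  mul_mul_mul_comm _ _ _ _

theorem setIntegral_fracTerm_mul (hα : 0 ≤ α) (hA : 0 < A) (hB : 0 < B) {z : ℝ} (hz : 0 < z)
    (p : ℕ × ℕ) :
    ∫ y in Ioo 0 z, fracTerm α A c y p.1 * fracTerm α B d (z - y) p.2 =
      fracMulTerm α A B c d z p := by
  simp only [fracTerm_mul_fracTerm]
  rw [integral_const_mul, setIntegral_fracKernel_mul (mul_natCast_add_pos hα hA p.1)
    (mul_natCast_add_pos hα hB p.2) hz, fracMulTerm]

theorem integrableOn_fracTerm_mul (hα : 0 ≤ α) (hA : 0 < A) (hB : 0 < B) {z : ℝ} (hz : 0 < z)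
    (p : ℕ × ℕ) :
    IntegrableOn (fun y => fracTerm α A c y p.1 * fracTerm α B d (z - y) p.2) (Ioo 0 z) := by
  simp only [fracTerm_mul_fracTerm]
  exact (integrableOn_fracKernel_mul (mul_natCast_add_pos hα hA p.1)
    (mul_natCast_add_pos hα hB p.2) hz).const_mul _

theorem setIntegral_norm_fracTerm_mul (hα : 0 ≤ α) (hA : 0 < A) (hB : 0 < B) {z : ℝ} (hz : 0 < z)
    (p : ℕ × ℕ) :
    ∫ y in Ioo 0 z, ‖fracTerm α A c y p.1 * fracTerm α B d (z - y) p.2‖ =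
      ‖fracMulTerm α A B c d z p‖ := by
  have ha := mul_natCast_add_pos hα hA p.1
  have hb := mul_natCast_add_pos hα hB p.2
  rw [fracMulTerm, norm_mul, Real.norm_of_nonneg (fracKernel_pos (add_pos ha hb) hz).le,
    ← setIntegral_fracKernel_mul ha hb hz, ← integral_const_mul]
  refine setIntegral_congr_fun measurableSet_Ioo fun y hy => ?_
  have hka := fracKernel_pos ha hy.1
  have hkb := fracKernel_pos hb (sub_pos.2 hy.2)
  simp only [fracTerm, norm_mul, Real.norm_of_nonneg hka.le, Real.norm_of_nonneg hkb.le]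
  ring

theorem setIntegral_fracSeries_mul (hα : 0 ≤ α) (hA : 0 < A) (hB : 0 < B)
    (hc : ∀ r, 0 < r → Summable (fracTerm α A c r))
    (hd : ∀ r, 0 < r → Summable (fracTerm α B d r)) {z : ℝ} (hz : 0 < z) :
    ∫ y in Ioo 0 z, fracSeries α A c y * fracSeries α B d (z - y) =
      fracSeries α (A + B) (c * d) z := by
  have hprod : ∀ y ∈ Ioo 0 z, fracSeries α A c y * fracSeries α B d (z - y) =
      ∑' p : ℕ × ℕ, fracTerm α A c y p.1 * fracTerm α B d (z - y) p.2 := fun y hy =>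
    tsum_mul_tsum_of_summable_norm (hc y hy.1).norm (hd _ (sub_pos.2 hy.2)).norm
  have hnorm : Summable fun p : ℕ × ℕ =>
      ∫ y in Ioo 0 z, ‖fracTerm α A c y p.1 * fracTerm α B d (z - y) p.2‖ := by
    simpa only [setIntegral_norm_fracTerm_mul hα hA hB hz] using
      summable_norm_fracMulTerm hα hA hB hz (hc z hz) (hd z hz)
  rw [setIntegral_congr_fun measurableSet_Ioo hprod,
    ← integral_tsum_of_summable_integral_norm (integrableOn_fracTerm_mul hα hA hB hz) hnorm]
  simp only [setIntegral_fracTerm_mul hα hA hB hz]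
  exact (hasSum_fracTerm_mul hα hA hB hz (hc z hz) (hd z hz)).tsum_eq.symm

theorem setIntegral_fracSeries (hα : 0 ≤ α) (hA : 0 < A)
    (hc : ∀ r, 0 < r → Summable (fracTerm α A c r)) {z : ℝ} (hz : 0 < z) :
    ∫ y in Ioo 0 z, fracSeries α A c y = fracSeries α (A + 1) c z := by
  have hone (r : ℝ) : fracSeries α 1 1 r = 1 := by
    rw [fracSeries, (hasSum_fracTerm_one α 1 r).tsum_eq, fracKernel_one]
  simpa only [hone, mul_one] using setIntegral_fracSeries_mul hα hA one_pos hc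
    (fun r _ => (hasSum_fracTerm_one α 1 r).summable) hz

theorem summable_fracTerm_add_one (hα : 0 ≤ α) (hA : 0 < A) {z : ℝ} (hz : 0 < z)
    (hc : Summable (fracTerm α A c z)) : Summable (fracTerm α (A + 1) c z) := by
  simpa only [mul_one] using
    (hasSum_fracTerm_mul hα hA one_pos hz hc (hasSum_fracTerm_one α 1 z).summable).summable

end FracSeries

namespace HasPosDensity

variable {Ω : Type*} [MeasurableSpace Ω] {P : Measure Ω} {X Y : Ω → ℝ} {f g : ℝ → ℝ}

theorem congr (hX : HasPosDensity P X f) (hfg : ∀ r, 0 < r → f r = g r) : HasPosDensity P X g where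
  hasPDF := hX.hasPDF
  nonneg r hr := hfg r hr ▸ hX.nonneg r hr
  pdf_ae := hX.pdf_ae.trans <| .of_forall fun r => by
    by_cases hr : 0 < r <;> simp [hr, hfg]

theorem aestronglyMeasurable_restrict (hX : HasPosDensity P X f) :
    AEStronglyMeasurable f (volume.restrict (Ioi 0)) := by
  refine AEStronglyMeasurable.congr
    (measurable_pdf X P volume).ennreal_toReal.aestronglyMeasurable ?_
  filter_upwards [ae_restrict_of_ae hX.pdf_ae, ae_restrict_mem measurableSet_Ioi] with r hpdf hr
  rw [hpdf, if_pos (mem_Ioi.1 hr), ENNReal.toReal_ofReal (hX.nonneg r hr)]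

theorem map_Iic (hX : HasPosDensity P X f) (r : ℝ) :
    P.map X (Iic r) = ∫⁻ y in Ioo 0 r, ENNReal.ofReal (f y) := by
  have := hX.hasPDF
  rw [map_eq_setLIntegral_pdf X P volume measurableSet_Iic, setLIntegral_congr Iio_ae_eq_Iic.symm,
    ← lintegral_indicator measurableSet_Iio, ← lintegral_indicator measurableSet_Ioo]
  refine lintegral_congr_ae ?_
  filter_upwards [hX.pdf_ae] with y hpdf
  by_cases h0 : 0 < y <;> by_cases h1 : y < r <;> simp [indicator, hpdf, h0, h1]

theorem cdf_eq_setIntegral [IsProbabilityMeasure P] (hX : HasPosDensity P X f) (r : ℝ) :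
    cdf (P.map X) r = ∫ y in Ioo 0 r, f y := by
  have := hX.hasPDF
  have := Measure.isProbabilityMeasure_map (HasPDF.aemeasurable X P volume)
  rw [cdf_eq_real, Measure.real, hX.map_Iic, integral_eq_lintegral_of_nonneg_ae]
  · exact ae_restrict_of_forall_mem measurableSet_Ioo fun y hy => hX.nonneg y hy.1
  · exact hX.aestronglyMeasurable_restrict.mono_set Ioo_subset_Ioi_self

variable [IsFiniteMeasure P]

theorem pdf_add_ae (hX : HasPosDensity P X f) (hY : HasPosDensity P Y g) (hXY : IndepFun X Y P) :
    pdf (X + Y) P volume =ᵐ[volume]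
      fun z => ∫⁻ y in Ioo 0 z, ENNReal.ofReal (f y * g (z - y)) := by
  have := hX.hasPDF
  have := hY.hasPDF
  filter_upwards [hXY.pdf_add_eq_lconvolution_pdf (μ := volume)] with z hz
  have hY_reflect : ∀ᵐ y : ℝ, pdf Y P volume (z - y) =
      ENNReal.ofReal (if 0 < z - y then g (z - y) else 0) :=
    (Measure.measurePreserving_sub_left volume z).quasiMeasurePreserving.ae hY.pdf_ae
  rw [hz, lconvolution_def, ← lintegral_indicator measurableSet_Ioo]
  refine lintegral_congr_ae ?_
  filter_upwards [hX.pdf_ae, hY_reflect] with y hXy hYy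
  rw [neg_add_eq_sub, hXy, hYy]
  by_cases h0 : 0 < y
  · by_cases h1 : y < z <;> simp [h0, h1, ENNReal.ofReal_mul (hX.nonneg y h0)]
  · simp [h0]

theorem add (hX : HasPosDensity P X f) (hY : HasPosDensity P Y g) (hXY : IndepFun X Y P) :
    HasPosDensity P (X + Y) fun z => ∫ y in Ioo 0 z, f y * g (z - y) := by
  have := hX.hasPDF
  have := hY.hasPDF
  have hnonneg (z : ℝ) : ∀ y ∈ Ioo 0 z, 0 ≤ f y * g (z - y) := fun y hy =>
    mul_nonneg (hX.nonneg y hy.1) (hY.nonneg _ (sub_pos.2 hy.2))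
  have hmeas (z : ℝ) :
      AEStronglyMeasurable (fun y => f y * g (z - y)) (volume.restrict (Ioo 0 z)) := by
    refine (hX.aestronglyMeasurable_restrict.mono_set Ioo_subset_Ioi_self).mul ?_
    refine hY.aestronglyMeasurable_restrict.comp_quasiMeasurePreserving
      (((Measure.measurePreserving_sub_left volume z).restrict_preimage
        measurableSet_Ioi).quasiMeasurePreserving.mono_left ?_)
    have hsub : Ioo 0 z ⊆ (fun y => z - y) ⁻¹' Ioi 0 := fun _ hy => sub_pos.2 hy.2
    exact (Measure.restrict_mono hsub le_rfl).absolutelyContinuous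
  refine ⟨hXY.add_hasPDF, fun z _ => setIntegral_nonneg measurableSet_Ioo (hnonneg z), ?_⟩
  have hfinite : ∀ᵐ z, pdf (X + Y) P volume z < ⊤ := pdf.ae_lt_top
  filter_upwards [hX.pdf_add_ae hY hXY, hfinite] with z hpdf hlt
  split_ifs with hz
  · rw [integral_eq_lintegral_of_nonneg_ae
      (ae_restrict_of_forall_mem measurableSet_Ioo (hnonneg z)) (hmeas z), ← hpdf,
      ENNReal.ofReal_toReal hlt.ne]
  · simp [hpdf, Ioo_eq_empty hz]

end HasPosDensity

/-- `X` is supported on `[0, ∞)` and its density is there the everywhere convergent fractional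
power series `fracSeries α A c`. -/
structure HasFracSeriesDensity {Ω : Type*} [MeasurableSpace Ω] (P : Measure Ω) (X : Ω → ℝ)
    (α A : ℝ) (c : ℝ⟦X⟧) : Prop where
  summable : ∀ r : ℝ, 0 < r → Summable (fracTerm α A c r)
  density : HasPosDensity P X (fracSeries α A c)

namespace HasFracSeriesDensity

variable {Ω : Type*} [MeasurableSpace Ω] {P : Measure Ω} {X Y : Ω → ℝ} {α A B : ℝ} {c d : ℝ⟦X⟧}

theorem add [IsFiniteMeasure P] (hα : 0 ≤ α) (hA : 0 < A) (hB : 0 < B)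
    (hX : HasFracSeriesDensity P X α A c) (hY : HasFracSeriesDensity P Y α B d)
    (hXY : IndepFun X Y P) : HasFracSeriesDensity P (X + Y) α (A + B) (c * d) where
  summable r hr :=
    (hasSum_fracTerm_mul hα hA hB hr (hX.summable r hr) (hY.summable r hr)).summable
  density := (hX.density.add hY.density hXY).congr fun _ hr =>
    setIntegral_fracSeries_mul hα hA hB hX.summable hY.summable hr

theorem sum {ι : Type*} [IsFiniteMeasure P] {X : ι → Ω → ℝ} {A : ι → ℝ} {c : ι → ℝ⟦X⟧}
    (hα : 0 ≤ α) (hA : ∀ i, 0 < A i) (hX : ∀ i, HasFracSeriesDensity P (X i) α (A i) (c i))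
    (hindep : iIndepFun X P) {s : Finset ι} (hs : s.Nonempty) :
    HasFracSeriesDensity P (∑ i ∈ s, X i) α (∑ i ∈ s, A i) (∏ i ∈ s, c i) := by
  have hmeas (i : ι) : AEMeasurable (X i) P :=
    have := (hX i).density.hasPDF
    HasPDF.aemeasurable (X i) P volume
  induction hs using Finset.Nonempty.cons_induction with
  | singleton i => simpa using hX i
  | cons i s hi hs ih =>
    simpa only [Finset.sum_cons, Finset.prod_cons] using
      (hX i).add hα (hA i) (Finset.sum_pos (fun i _ => hA i) hs) ih
        (hindep.indepFun_finsetSum_of_notMem₀ hmeas hi).symm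

theorem summable_add_one (hα : 0 ≤ α) (hA : 0 < A) (hX : HasFracSeriesDensity P X α A c) {r : ℝ}
    (hr : 0 ≤ r) : Summable (fracTerm α (A + 1) c r) := by
  obtain rfl | hr := hr.eq_or_lt
  · rw [fracTerm_zero_right hα (by linarith)]
    exact summable_zero
  · exact summable_fracTerm_add_one hα hA hr (hX.summable r hr)

theorem cdf_eq_fracSeries [IsProbabilityMeasure P] (hα : 0 ≤ α) (hA : 0 < A)
    (hX : HasFracSeriesDensity P X α A c) {r : ℝ} (hr : 0 ≤ r) :
    cdf (P.map X) r = fracSeries α (A + 1) c r := by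
  rw [hX.density.cdf_eq_setIntegral]
  obtain rfl | hr := hr.eq_or_lt
  · simp [fracSeries, fracTerm_zero_right hα (show 1 < A + 1 by linarith)]
  · exact setIntegral_fracSeries hα hA hX.summable hr

end HasFracSeriesDensity

section Mixture

variable {α T rhat r : ℝ} {φ : ℕ → ℝ}

theorem mixtureTerm_eq (φ : ℕ → ℝ) (hr : 0 < r) (hrhat : 0 < rhat) (i : ℕ) :
    mixtureTerm α T rhat φ r i = r ^ (α * T - 1) / rhat ^ (α * T) *
      (φ i / Real.Gamma (i + T) * (r ^ α / rhat ^ α) ^ i) := by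
  have hnum : r ^ (α * (i + T) - 1) = r ^ (α * T - 1) * (r ^ α) ^ i := by
    rw [← Real.rpow_mul_natCast hr.le, ← Real.rpow_add hr]
    ring_nf
  have hden : rhat ^ (α * (i + T)) = rhat ^ (α * T) * (rhat ^ α) ^ i := by
    rw [← Real.rpow_mul_natCast hrhat.le, ← Real.rpow_add hrhat]
    ring_nf
  rw [mixtureTerm, hnum, hden, div_pow]
  simp only [div_eq_mul_inv, mul_inv]
  ring

theorem sum_antidiagonal_mul_exp_term (φ : ℕ → ℝ) (T x : ℝ) (n : ℕ) :
    ∑ p ∈ antidiagonal n,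
        φ p.1 / Real.Gamma (p.1 + T) * x ^ p.1 * ((-x) ^ p.2 / (p.2.factorial : ℝ)) =
      (∑ j ∈ Finset.range (n + 1),
        (-1) ^ (n - j) * φ j / (((n - j).factorial : ℝ) * Real.Gamma (j + T))) * x ^ n := by
  rw [Finset.Nat.sum_antidiagonal_eq_sum_range_succ
    (fun i j => φ i / Real.Gamma (i + T) * x ^ i * ((-x) ^ j / (j.factorial : ℝ))),
    Finset.sum_mul]
  refine Finset.sum_congr rfl fun j hj => ?_
  have hpow : x ^ n = x ^ j * x ^ (n - j) := by
    rw [← pow_add, Nat.add_sub_of_le (Nat.lt_succ_iff.1 (Finset.mem_range.1 hj))]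
  rw [neg_pow x, hpow]
  simp only [div_eq_mul_inv, mul_inv]
  ring

theorem fracTerm_mk_lam (φ : ℕ → ℝ) (hα : 0 < α) (hT : 0 < T) (hr : 0 < r) (hrhat : 0 ≤ rhat)
    (n : ℕ) :
    fracTerm α (α * T) (mk (lam α T rhat φ)) r n = r ^ (α * T - 1) *
      ∑ p ∈ antidiagonal n, φ p.1 / Real.Gamma (p.1 + T) * (r ^ α / rhat ^ α) ^ p.1 *
        ((-(r ^ α / rhat ^ α)) ^ p.2 / (p.2.factorial : ℝ)) := by
  have hΓ : Real.Gamma (α * (n + T)) ≠ 0 := (Real.Gamma_pos_of_pos (by positivity)).ne'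
  have hnum : r ^ (α * n + α * T - 1) = r ^ (α * T - 1) * (r ^ α) ^ n := by
    rw [← Real.rpow_mul_natCast hr.le, ← Real.rpow_add hr]
    ring_nf
  rw [sum_antidiagonal_mul_exp_term, fracTerm, coeff_mk, lam, fracKernel, hnum,
    Real.rpow_mul_natCast hrhat, ← mul_add, div_pow]
  field_simp

theorem lam_zero_ne_zero (hα : 0 < α) (hT : 0 < T) (hφ : φ 0 ≠ 0) : lam α T rhat φ 0 ≠ 0 := by
  have hΓαT := (Real.Gamma_pos_of_pos (mul_pos hα hT)).ne'
  have hΓT := (Real.Gamma_pos_of_pos hT).ne'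
  simp [lam, hΓαT, hΓT, hφ]

namespace IsMixture

variable {Ω : Type*} [MeasurableSpace Ω] {P : Measure Ω} {X : Ω → ℝ}

theorem summable_coeff_mul_pow (hrhat : 0 < rhat) (hX : IsMixture P X α T rhat φ) (hr : 0 < r) :
    Summable fun i : ℕ => φ i / Real.Gamma (i + T) * (r ^ α / rhat ^ α) ^ i := by
  have hmix := hX.summable r hr
  rw [funext (mixtureTerm_eq φ hr hrhat)] at hmix
  exact (summable_mul_left_iff (by positivity)).1 hmix

theorem summable_fracTerm_mk_lam (hα : 0 < α) (hT : 0 < T) (hrhat : 0 < rhat)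
    (hX : IsMixture P X α T rhat φ) (hr : 0 < r) :
    Summable (fracTerm α (α * T) (PowerSeries.mk (lam α T rhat φ)) r) := by
  rw [funext (fracTerm_mk_lam φ hα hT hr hrhat.le)]
  exact (summable_norm_sum_mul_antidiagonal_of_summable_norm
    (hX.summable_coeff_mul_pow hrhat hr).norm
    (Real.summable_pow_div_factorial _).norm).of_norm.mul_left _

theorem mixtureDensity_eq_fracSeries (hα : 0 < α) (hT : 0 < T) (hrhat : 0 < rhat)
    (hX : IsMixture P X α T rhat φ) (hr : 0 < r) :
    mixtureDensity α T rhat φ r =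
      fracSeries α (α * T) (C (α / rhat ^ (α * T)) * PowerSeries.mk (lam α T rhat φ)) r := by
  have hcauchy := tsum_mul_tsum_eq_tsum_sum_antidiagonal_of_summable_norm
    (hX.summable_coeff_mul_pow hrhat hr).norm
    (Real.summable_pow_div_factorial (-(r ^ α / rhat ^ α))).norm
  rw [fracSeries_C_mul, fracSeries, tsum_congr (fracTerm_mk_lam φ hα hT hr hrhat.le),
    tsum_mul_left, ← hcauchy, mixtureDensity, tsum_congr (mixtureTerm_eq φ hr hrhat),
    tsum_mul_left, Real.exp_eq_exp_ℝ, NormedSpace.exp_eq_tsum_div]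
  ring

theorem hasFracSeriesDensity (hα : 0 < α) (hT : 0 < T) (hrhat : 0 < rhat)
    (hX : IsMixture P X α T rhat φ) :
    HasFracSeriesDensity P X α (α * T)
      (C (α / rhat ^ (α * T)) * PowerSeries.mk (lam α T rhat φ)) where
  summable _ hr := (summable_fracTerm_C_mul_iff (by positivity)).2
    (hX.summable_fracTerm_mk_lam hα hT hrhat hr)
  density := hX.density.congr fun _ hr => hX.mixtureDensity_eq_fracSeries hα hT hrhat hr

end IsMixture

end Mixture

section LogarithmicDerivative

theorem derivation_prod_eq_prod_mul_sum {R A ι : Type*} [CommSemiring R] [CommSemiring A]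
    [Algebra R A] (D : Derivation R A A) (s : Finset ι) {f g : ι → A}
    (h : ∀ i ∈ s, D (f i) = f i * g i) :
    D (∏ i ∈ s, f i) = (∏ i ∈ s, f i) * ∑ i ∈ s, g i := by
  induction s using Finset.cons_induction with
  | empty => simp
  | cons i s hi ih =>
    rw [Finset.prod_cons, Finset.sum_cons, Derivation.leibniz,
      ih fun j hj => h j (Finset.mem_cons_of_mem hj), h i (Finset.mem_cons_self i s),
      smul_eq_mul, smul_eq_mul]
    ring

theorem eq_of_derivative_eq_mul {R : Type*} [CommRing R] [IsDomain R] [CharZero R] {F G H : R⟦X⟧}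
    (hF : d⁄dX R F = F * H) (hG : d⁄dX R G = G * H)
    (h0 : constantCoeff F = constantCoeff G) : F = G := by
  ext n
  induction n using Nat.strong_induction_on with
  | _ n ih =>
    cases n with
    | zero => simpa only [coeff_zero_eq_constantCoeff_apply] using h0
    | succ n =>
      have hsucc : coeff (n + 1) F * (n + 1) = coeff (n + 1) G * (n + 1) := by
        rw [← coeff_derivative, ← coeff_derivative, hF, hG, coeff_mul, coeff_mul]
        refine Finset.sum_congr rfl fun p hp => ?_
        rw [ih p.1 (Nat.lt_succ_of_le (antidiagonal.fst_le hp))]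
      exact mul_right_cancel₀ n.cast_add_one_ne_zero hsucc

theorem derivative_mk_eq_mul_phiCoeff {η : ℕ → ℝ} (h0 : η 0 ≠ 0) :
    d⁄dX ℝ (mk η) = mk η * mk (phiCoeff η) := by
  ext h
  rw [coeff_derivative, coeff_mul, coeff_mk, Finset.Nat.sum_antidiagonal_eq_sum_range_succ
    (fun i j => coeff i (mk η) * coeff j (mk (phiCoeff η))), Finset.sum_range_succ']
  simp only [coeff_mk, Nat.sub_zero]
  rw [phiCoeff, Fin.sum_univ_eq_sum_range (fun t => η (t + 1) * phiCoeff η (h - (t + 1)))]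
  field_simp
  ring

theorem derivative_mk_deltaCoeff {L : ℕ} (η : Fin L → ℕ → ℝ) :
    d⁄dX ℝ (mk (deltaCoeff η)) = mk (deltaCoeff η) * ∑ ℓ, mk (phiCoeff (η ℓ)) := by
  ext n
  rw [coeff_derivative, mul_comm (mk _), coeff_mul, coeff_mk,
    Finset.Nat.sum_antidiagonal_eq_sum_range_succ
      (fun i j => coeff i (∑ ℓ, mk (phiCoeff (η ℓ))) * coeff j (mk (deltaCoeff η))),
    deltaCoeff, Fin.sum_univ_eq_sum_range
      (fun h => deltaCoeff η (n - h) * ∑ ℓ, phiCoeff (η ℓ) h)]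
  field_simp
  refine Finset.sum_congr rfl fun h _ => ?_
  simp only [map_sum, coeff_mk, mul_comm]

theorem mk_deltaCoeff {L : ℕ} {η : Fin L → ℕ → ℝ} (h0 : ∀ ℓ, η ℓ 0 ≠ 0) :
    mk (deltaCoeff η) = ∏ ℓ, mk (η ℓ) := by
  refine eq_of_derivative_eq_mul (derivative_mk_deltaCoeff η)
    (derivation_prod_eq_prod_mul_sum _ _ fun ℓ _ => derivative_mk_eq_mul_phiCoeff (h0 ℓ)) ?_
  simp [← coeff_zero_eq_constantCoeff_apply, deltaCoeff_zero, map_prod]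

end LogarithmicDerivative

theorem hasFracSeriesDensity_sum_mixture {Ω : Type*} [MeasurableSpace Ω] {P : Measure Ω}
    [IsFiniteMeasure P] {L : ℕ} (hL : 1 ≤ L) {α : ℝ} (hα : 0 < α) {T rhat : Fin L → ℝ}
    (hT : ∀ ℓ, 0 < T ℓ) (hrhat : ∀ ℓ, 0 < rhat ℓ) {φ : Fin L → ℕ → ℝ} (hφ : ∀ ℓ, φ ℓ 0 ≠ 0)
    {R : Fin L → Ω → ℝ} (hR : ∀ ℓ, IsMixture P (R ℓ) α (T ℓ) (rhat ℓ) (φ ℓ))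
    (hindep : iIndepFun R P) :
    HasFracSeriesDensity P (fun ω => ∑ ℓ, R ℓ ω) α (α * ∑ ℓ, T ℓ)
      (C (α ^ L * ∏ ℓ, 1 / rhat ℓ ^ (α * T ℓ)) *
        mk (deltaCoeff fun ℓ => lam α (T ℓ) (rhat ℓ) (φ ℓ))) := by
  have : Nonempty (Fin L) := Fin.pos_iff_nonempty.1 hL
  have hconst : α ^ L * ∏ ℓ, 1 / rhat ℓ ^ (α * T ℓ) = ∏ ℓ, α / rhat ℓ ^ (α * T ℓ) := by
    simp [div_eq_mul_inv, Finset.prod_mul_distrib]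
  rw [hconst, mk_deltaCoeff fun ℓ => lam_zero_ne_zero hα (hT ℓ) (hφ ℓ), map_prod,
    ← Finset.prod_mul_distrib, Finset.mul_sum, ← Finset.sum_fn]
  exact HasFracSeriesDensity.sum hα.le (fun ℓ => mul_pos hα (hT ℓ))
    (fun ℓ => (hR ℓ).hasFracSeriesDensity hα (hT ℓ) (hrhat ℓ)) hindep Finset.univ_nonempty

end AlphaMu

end

theorem proposition2 {Ω : Type*} [MeasurableSpace Ω] (P : MeasureTheory.Measure Ω)
    [MeasureTheory.IsProbabilityMeasure P]
    (L : ℕ) (hL : 1 ≤ L)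
    (α : ℝ) (hα : 0 < α)
    (T : Fin L → ℝ) (hT : ∀ ℓ, 0 < T ℓ)
    (rhat : Fin L → ℝ) (hrhat : ∀ ℓ, 0 < rhat ℓ)
    (φ : Fin L → ℕ → ℝ) (hφ : ∀ ℓ, φ ℓ 0 ≠ 0)
    (R : Fin L → Ω → ℝ)
    (hR : ∀ ℓ, AlphaMu.IsMixture P (R ℓ) α (T ℓ) (rhat ℓ) (φ ℓ))
    (hindep : ProbabilityTheory.iIndepFun R P)
    (δ : ℕ → ℝ)
    (hδ : δ = AlphaMu.deltaCoeff fun ℓ => AlphaMu.lam α (T ℓ) (rhat ℓ) (φ ℓ)) :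
    (∀ r : ℝ, 0 < r → Summable fun i : ℕ =>
      δ i * r ^ (-1 + α * i + α * ∑ ℓ, T ℓ) / Real.Gamma (i * α + α * ∑ ℓ, T ℓ)) ∧
    AlphaMu.HasPosDensity P (fun ω => ∑ ℓ, R ℓ ω) (fun r =>
      α ^ L * (∏ ℓ, 1 / rhat ℓ ^ (α * T ℓ)) *
        ∑' i : ℕ,
          δ i * r ^ (-1 + α * i + α * ∑ ℓ, T ℓ) / Real.Gamma (i * α + α * ∑ ℓ, T ℓ)) ∧
    (∀ r : ℝ, 0 ≤ r →
      (Summable fun i : ℕ =>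
        δ i * r ^ (α * i + α * ∑ ℓ, T ℓ) / Real.Gamma (1 + i * α + α * ∑ ℓ, T ℓ)) ∧
      ProbabilityTheory.cdf (P.map fun ω => ∑ ℓ, R ℓ ω) r =
        α ^ L * (∏ ℓ, 1 / rhat ℓ ^ (α * T ℓ)) *
          ∑' i : ℕ,
            δ i * r ^ (α * i + α * ∑ ℓ, T ℓ) / Real.Gamma (1 + i * α + α * ∑ ℓ, T ℓ)) := by
  subst hδ
  set δ := AlphaMu.deltaCoeff fun ℓ => AlphaMu.lam α (T ℓ) (rhat ℓ) (φ ℓ)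
  set A := α * ∑ ℓ, T ℓ
  set K := α ^ L * ∏ ℓ, 1 / rhat ℓ ^ (α * T ℓ)
  have : Nonempty (Fin L) := Fin.pos_iff_nonempty.1 hL
  have hA : 0 < A := mul_pos hα (Finset.sum_pos (fun ℓ _ => hT ℓ) Finset.univ_nonempty)
  have hK : K ≠ 0 := ne_of_gt <|
    mul_pos (pow_pos hα L) (Finset.prod_pos fun ℓ _ => by have := hrhat ℓ; positivity)
  have pdf_term (r : ℝ) : (fun i : ℕ => δ i * r ^ (-1 + α * i + A) / Real.Gamma (i * α + A)) =
      AlphaMu.fracTerm α A (.mk δ) r := by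
    funext i
    rw [AlphaMu.fracTerm, AlphaMu.fracKernel, PowerSeries.coeff_mk, mul_div_assoc]
    ring_nf
  have cdf_term (r : ℝ) : (fun i : ℕ => δ i * r ^ (α * i + A) / Real.Gamma (1 + i * α + A)) =
      AlphaMu.fracTerm α (A + 1) (.mk δ) r := by
    funext i
    rw [AlphaMu.fracTerm, AlphaMu.fracKernel, PowerSeries.coeff_mk, mul_div_assoc]
    ring_nf
  have hsum := AlphaMu.hasFracSeriesDensity_sum_mixture hL hα hT hrhat hφ hR hindep
  simp only [pdf_term, cdf_term]
  exact ⟨fun r hr => (AlphaMu.summable_fracTerm_C_mul_iff hK).1 (hsum.summable r hr),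
    hsum.density.congr fun r _ => AlphaMu.fracSeries_C_mul α A K (.mk δ) r,
    fun r hr => ⟨(AlphaMu.summable_fracTerm_C_mul_iff hK).1 (hsum.summable_add_one hα.le hA hr),
      (hsum.cdf_eq_fracSeries hα.le hA hr).trans (AlphaMu.fracSeries_C_mul α (A + 1) K _ r)⟩⟩
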